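/- Terminology. Extriangulated categories $(\mathcal D,\mathbb E,\mathfrak s)$ are taken in the sense of Nakaoka and Palu, with their $\mathbb E$-triangles $X\to Y\to Z\dashrightarrow$; in such an $\mathbb E$-triangle $X\to Y$ is called an inflation, $Y\to Z$ a deflation, and $X$ the cocone of $Y\to Z$. All extriangulated categories below satisfy condition (WIC): if $gf$ is an inflation then $f$ is an inflation, and if $gf$ is a deflation then $g$ is a deflation. An object $P$ is projective if every morphism from $P$ to the target of a deflation factors through that deflation; $\mathcal D$ has enough projective objects if every object $M$ admits an $\mathbb E$-triangle $K\to P\to M\dashrightarrow$ with $P$ projective. A morphism is compatible if it is either not an inflation, or not a deflation, or an isomorphism. A sequence $X\xrightarrow{f}Y\xrightarrow{g}Z$ is right exact if $f=h_2h_1$ with $h_1:X\to K$ a compatible deflation and $K\xrightarrow{h_2}Y\xrightarrow{g}Z\dashrightarrow$ an $\mathbb E$-triangle; left exact sequences are defined dually. A four-term sequence $X\xrightarrow{f}Y\xrightarrow{g}Z\xrightarrow{h}W$ is right exact (resp. left exact) if there are $\mathbb E$-triangles $X\xrightarrow{f}Y\xrightarrow{g_1}K\dashrightarrow$ and $K\xrightarrow{g_2}Z\xrightarrow{h}W\dashrightarrow$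 with $g=g_2g_1$ and $g_1$ (resp. $g_2$) compatible. An additive functor which preserves compatible morphisms is right exact (resp. left exact, exact) if it also preserves right exact sequences (resp. left exact sequences, $\mathbb E$-triangles, that is, it sends the underlying sequence of each $\mathbb E$-triangle to the underlying sequence of an $\mathbb E$-triangle). A recollement $(\mathcal A,\mathcal B,\mathcal C)$ of extriangulated categories consists of exact functors $i_*:\mathcal A\to\mathcal B$ and $j^*:\mathcal B\to\mathcal C$, right exact functors $i^*:\mathcal B\to\mathcal A$ and $j_!:\mathcal C\to\mathcal B$, and left exact functors $i^!:\mathcal B\to\mathcal A$ and $j_*:\mathcal C\to\mathcal B$ such that: $(i^*,i_*,i^!)$ and $(j_!,j^*,j_*)$ are adjoint triples; the essential image of $i_*$ is the class of objects killed by $j^*$; $i_*,j_!,j_*$ are fully faithful; and for each $B\in\mathcal B$ there are $A,A'\in\mathcal A$, a left exact four-term sequence $i_*i^!B\to B\to j_*j^*B\to i_*A$ and a right exact four-term sequence $i_*A'\to j_!j^*B\to B\to i_*i^*B$, in which the morphisms to and from $B$ are the adjunction morphisms. A resolving subcategory of $\mathcal D$ is a full additive subcategory, closed under isomorphisms, which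 contains all projective objects and is closed under extensions and under cocones. For such an $\mathcal X$ and an object $M$, $\mathcal X\text{-}\mathrm{res}\,M\in\{0,1,2,\dots,\infty\}$ is the infimum of the $n\ge 0$ for which there are $\mathbb E$-triangles $K_{i+1}\to X_i\to K_i\dashrightarrow$ $(0\le i\le n)$ with $X_i\in\mathcal X$, $K_0\cong M$ and $K_{n+1}=0$ (an $\mathbb E$-triangle sequence $0\to X_n\to\cdots\to X_0\to M\to 0$). For a class $\mathcal Y$ of objects, $\mathcal X\text{-}\mathrm{res}\,\mathcal Y=\sup\{\mathcal X\text{-}\mathrm{res}\,M\mid M\in\mathcal Y\}$. For a functor $F$, $F(\mathcal Y)$ denotes the class of objects isomorphic to some $F(M)$ with $M\in\mathcal Y$. Theorem. Let $(\mathcal A,\mathcal B,\mathcal C)$ be a recollement of extriangulated categories, and assume that $\mathcal B$ and $\mathcal C$ have enough projective objects. Let $\mathcal X_{\mathcal A},\mathcal X_{\mathcal B},\mathcal X_{\mathcal C}$ be resolving subcategories of $\mathcal A,\mathcal B,\mathcal C$ respectively. Then the following hold in $\mathbb N\cup\{\infty\}$. (1) $\mathcal X_{\mathcal B}\text{-}\mathrm{res}\,\mathcal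 B\le \mathcal X_{\mathcal C}\text{-}\mathrm{res}\,\mathcal C+\max\{\mathcal X_{\mathcal B}\text{-}\mathrm{res}\,i_*(\mathcal A),\ \mathcal X_{\mathcal B}\text{-}\mathrm{res}\,j_!(\mathcal X_{\mathcal C})\}+1$. (2) $\mathcal X_{\mathcal B}\text{-}\mathrm{res}\,i_*(\mathcal A)\le \mathcal X_{\mathcal A}\text{-}\mathrm{res}\,\mathcal A+\mathcal X_{\mathcal B}\text{-}\mathrm{res}\,i_*(\mathcal X_{\mathcal A})$. (3) $\mathcal X_{\mathcal B}\text{-}\mathrm{res}\,\mathcal B\le \mathcal X_{\mathcal A}\text{-}\mathrm{res}\,\mathcal A+\mathcal X_{\mathcal C}\text{-}\mathrm{res}\,\mathcal C+\max\{\mathcal X_{\mathcal B}\text{-}\mathrm{res}\,i_*(\mathcal X_{\mathcal A}),\ \mathcal X_{\mathcal B}\text{-}\mathrm{res}\,j_!(\mathcal X_{\mathcal C})\}+1$. (4) $\mathcal X_{\mathcal C}\text{-}\mathrm{res}\,\mathcal C\le \mathcal X_{\mathcal B}\text{-}\mathrm{res}\,\mathcal B+\mathcal X_{\mathcal C}\text{-}\mathrm{res}\,j^*(\mathcal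 X_{\mathcal B})$. (5) If $j_!(\mathcal X_{\mathcal C})\subseteq\mathcal X_{\mathcal B}$ or $j_*(\mathcal X_{\mathcal C})\subseteq\mathcal X_{\mathcal B}$, then $\mathcal X_{\mathcal B}\text{-}\mathrm{res}\,\mathcal B\le \mathcal X_{\mathcal C}\text{-}\mathrm{res}\,\mathcal C+\mathcal X_{\mathcal B}\text{-}\mathrm{res}\,i_*(\mathcal A)+1$ and $\mathcal X_{\mathcal B}\text{-}\mathrm{res}\,\mathcal B\le \mathcal X_{\mathcal C}\text{-}\mathrm{res}\,\mathcal C+\mathcal X_{\mathcal A}\text{-}\mathrm{res}\,\mathcal A+\mathcal X_{\mathcal B}\text{-}\mathrm{res}\,i_*(\mathcal X_{\mathcal A})+1$. (6) If $i_*(\mathcal X_{\mathcal A})\subseteq\mathcal X_{\mathcal B}$, then $\mathcal X_{\mathcal B}\text{-}\mathrm{res}\,i_*(\mathcal A)\le \mathcal X_{\mathcal A}\text{-}\mathrm{res}\,\mathcal A$. (7) If ($j_!(\mathcal X_{\mathcal C})\subseteq\mathcal X_{\mathcal B}$ or $j_*(\mathcal X_{\mathcal C})\subseteq\mathcal X_{\mathcal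 B}$) and $i_*(\mathcal X_{\mathcal A})\subseteq\mathcal X_{\mathcal B}$, then $\mathcal X_{\mathcal B}\text{-}\mathrm{res}\,\mathcal B\le \mathcal X_{\mathcal A}\text{-}\mathrm{res}\,\mathcal A+\mathcal X_{\mathcal C}\text{-}\mathrm{res}\,\mathcal C+1$. (8) If $j^*(\mathcal X_{\mathcal B})\subseteq\mathcal X_{\mathcal C}$, then $\mathcal X_{\mathcal C}\text{-}\mathrm{res}\,\mathcal C\le \mathcal X_{\mathcal B}\text{-}\mathrm{res}\,\mathcal B$. -/

import Mathlib

open CategoryTheory CategoryTheory.Limits Opposite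

universe w v u w₁ v₁ u₁ w₂ v₂ u₂ w₃ v₃ u₃

namespace Extri

noncomputable section

section Extensions

variable {C : Type u} [Category.{v} C]

/-- The set (abelian group) `E(Z, X)` of extensions of `Z` by `X`. -/
abbrev Ext (E : Cᵒᵖ ⥤ C ⥤ AddCommGrpCat.{w}) (Z X : C) : Type w :=
  (E.obj (op Z)).obj X

/-- `a_* δ ∈ E(Z, X')` for `δ ∈ E(Z, X)` and `a : X ⟶ X'`. -/
def push (E : Cᵒᵖ ⥤ C ⥤ AddCommGrpCat.{w}) {Z X X' : C} (a : X ⟶ X') (δ : Ext E Z X) :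
    Ext E Z X' :=
  ((E.obj (op Z)).map a).hom δ

/-- `c^* δ ∈ E(Z', X)` for `δ ∈ E(Z, X)` and `c : Z' ⟶ Z`. -/
def pull (E : Cᵒᵖ ⥤ C ⥤ AddCommGrpCat.{w}) {Z Z' X : C} (c : Z' ⟶ Z) (δ : Ext E Z X) :
    Ext E Z' X :=
  ((E.map c.op).app X).hom δ

end Extensions

/-- The structure of an extriangulated category (in the sense of Nakaoka and Palu) on an
additive category `C`: an additive bifunctor `E : Cᵒᵖ × C → Ab`, an additive realization `𝔰`
of it, and the axioms (ET3), (ET3)ᵒᵖ, (ET4), (ET4)ᵒᵖ.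

The realization is encoded by the relation `Realizes x y δ`, which says that the sequence
`X ⟶ Y ⟶ Z` given by `x` and `y` belongs to the class `𝔰(δ)`. The first three fields about it say
that, for each `δ`, these sequences form exactly one equivalence class, where `(x, y)` and
`(x', y')` are equivalent when there is an isomorphism of the middle terms which commutes with
the identities of the end terms. -/
structure ExtriangulatedStructure (C : Type u) [Category.{v} C] [Preadditive C] [HasZeroObject C]
    [HasBinaryBiproducts C] where
  /-- the bifunctor of extensions -/
  E : Cᵒᵖ ⥤ C ⥤ AddCommGrpCat.{w}
  additive_left : E.Additive
  additive_right : ∀ Z : Cᵒᵖ, (E.obj Z).Additive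
  /-- `Realizes x y δ` means `𝔰(δ) = [x, y]` -/
  Realizes : ∀ {X Y Z : C}, (X ⟶ Y) → (Y ⟶ Z) → Ext E Z X → Prop
  exists_realizes : ∀ {X Z : C} (δ : Ext E Z X), ∃ (Y : C) (x : X ⟶ Y) (y : Y ⟶ Z),
    Realizes x y δ
  realizes_unique : ∀ {X Y Y' Z : C} {x : X ⟶ Y} {y : Y ⟶ Z} {x' : X ⟶ Y'} {y' : Y' ⟶ Z}
    {δ : Ext E Z X}, Realizes x y δ → Realizes x' y' δ →
      ∃ b : Y ≅ Y', x ≫ b.hom = x' ∧ b.hom ≫ y' = y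
  realizes_of_equiv : ∀ {X Y Y' Z : C} {x : X ⟶ Y} {y : Y ⟶ Z} {x' : X ⟶ Y'} {y' : Y' ⟶ Z}
    {δ : Ext E Z X} (b : Y ≅ Y'), x ≫ b.hom = x' → b.hom ≫ y' = y →
      Realizes x y δ → Realizes x' y' δ
  /-- `𝔰` is a realization: every morphism of extensions lifts to the middle terms -/
  exists_middle : ∀ {X Y Z X' Y' Z' : C} {x : X ⟶ Y} {y : Y ⟶ Z} {x' : X' ⟶ Y'} {y' : Y' ⟶ Z'}
    {δ : Ext E Z X} {δ' : Ext E Z' X'}, Realizes x y δ → Realizes x' y' δ' →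
      ∀ (a : X ⟶ X') (c : Z ⟶ Z'), push E a δ = pull E c δ' →
        ∃ b : Y ⟶ Y', x ≫ b = a ≫ x' ∧ b ≫ y' = y ≫ c
  /-- `𝔰(0) = [X → X ⊕ Z → Z]` -/
  realizes_zero : ∀ X Z : C,
    Realizes (biprod.inl : X ⟶ X ⊞ Z) (biprod.snd : X ⊞ Z ⟶ Z) (0 : Ext E Z X)
  /-- `𝔰(δ ⊕ δ') = 𝔰(δ) ⊕ 𝔰(δ')` -/
  realizes_biprod : ∀ {X Y Z X' Y' Z' : C} {x : X ⟶ Y} {y : Y ⟶ Z} {x' : X' ⟶ Y'} {y' : Y' ⟶ Z'}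
    {δ : Ext E Z X} {δ' : Ext E Z' X'}, Realizes x y δ → Realizes x' y' δ' →
      Realizes (biprod.map x x') (biprod.map y y')
        (pull E (biprod.fst : Z ⊞ Z' ⟶ Z) (push E (biprod.inl : X ⟶ X ⊞ X') δ) +
          pull E (biprod.snd : Z ⊞ Z' ⟶ Z') (push E (biprod.inr : X' ⟶ X ⊞ X') δ'))
  /-- (ET3) -/
  et3 : ∀ {X Y Z X' Y' Z' : C} {x : X ⟶ Y} {y : Y ⟶ Z} {x' : X' ⟶ Y'} {y' : Y' ⟶ Z'}
    {δ : Ext E Z X} {δ' : Ext E Z' X'}, Realizes x y δ → Realizes x' y' δ' →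
      ∀ (a : X ⟶ X') (b : Y ⟶ Y'), x ≫ b = a ≫ x' →
        ∃ c : Z ⟶ Z', push E a δ = pull E c δ' ∧ y ≫ c = b ≫ y'
  /-- (ET3)ᵒᵖ -/
  et3_op : ∀ {X Y Z X' Y' Z' : C} {x : X ⟶ Y} {y : Y ⟶ Z} {x' : X' ⟶ Y'} {y' : Y' ⟶ Z'}
    {δ : Ext E Z X} {δ' : Ext E Z' X'}, Realizes x y δ → Realizes x' y' δ' →
      ∀ (b : Y ⟶ Y') (c : Z ⟶ Z'), y ≫ c = b ≫ y' →
        ∃ a : X ⟶ X', push E a δ = pull E c δ' ∧ x ≫ b = a ≫ x'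
  /-- (ET4), for composable inflations `f : X₁ ⟶ X₂` and `g : X₂ ⟶ X₃` with cones `D` and `F` -/
  et4 : ∀ {X₁ X₂ X₃ D F : C} {f : X₁ ⟶ X₂} {f' : X₂ ⟶ D} {g : X₂ ⟶ X₃} {g' : X₃ ⟶ F}
    {δ : Ext E D X₁} {δ' : Ext E F X₂}, Realizes f f' δ → Realizes g g' δ' →
      ∃ (Q : C) (h' : X₃ ⟶ Q) (d : D ⟶ Q) (e : Q ⟶ F) (δ'' : Ext E Q X₁),
        f' ≫ d = g ≫ h' ∧ h' ≫ e = g' ∧ Realizes (f ≫ g) h' δ'' ∧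
        Realizes d e (push E f' δ') ∧ pull E d δ'' = δ ∧ push E f δ'' = pull E e δ'
  /-- (ET4)ᵒᵖ, for composable deflations `f : X₁ ⟶ X₂` and `g : X₂ ⟶ X₃` with cocones `D` and
  `F` -/
  et4_op : ∀ {X₁ X₂ X₃ D F : C} {f' : D ⟶ X₁} {f : X₁ ⟶ X₂} {g' : F ⟶ X₂} {g : X₂ ⟶ X₃}
    {δ : Ext E X₂ D} {δ' : Ext E X₃ F}, Realizes f' f δ → Realizes g' g δ' →
      ∃ (Q : C) (h' : Q ⟶ X₁) (d : D ⟶ Q) (e : Q ⟶ F) (δ'' : Ext E X₃ Q),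
        d ≫ h' = f' ∧ h' ≫ f = e ≫ g' ∧ Realizes h' (f ≫ g) δ'' ∧
        Realizes d e (pull E g' δ) ∧ push E e δ'' = δ' ∧ push E d δ = pull E g δ''

namespace ExtriangulatedStructure

variable {C : Type u} [Category.{v} C] [Preadditive C] [HasZeroObject C] [HasBinaryBiproducts C]
variable (S : ExtriangulatedStructure.{w} C)

/-- `X ⟶ Y ⟶ Z` is a conflation: it realizes some extension, i.e. it is the underlying sequence
of an `E`-triangle. -/
def IsConflation {X Y Z : C} (x : X ⟶ Y) (y : Y ⟶ Z) : Prop :=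
  ∃ δ : Ext S.E Z X, S.Realizes x y δ

def IsInflation {X Y : C} (x : X ⟶ Y) : Prop :=
  ∃ (Z : C) (y : Y ⟶ Z), S.IsConflation x y

def IsDeflation {Y Z : C} (y : Y ⟶ Z) : Prop :=
  ∃ (X : C) (x : X ⟶ Y), S.IsConflation x y

/-- Condition (WIC). -/
structure WIC : Prop where
  inflation_of_comp : ∀ {X Y Z : C} (f : X ⟶ Y) (g : Y ⟶ Z),
    S.IsInflation (f ≫ g) → S.IsInflation f
  deflation_of_comp : ∀ {X Y Z : C} (f : X ⟶ Y) (g : Y ⟶ Z),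
    S.IsDeflation (f ≫ g) → S.IsDeflation g

/-- `P` is projective: morphisms from `P` lift along every deflation. -/
def IsProjective (P : C) : Prop :=
  ∀ {Y Z : C} (y : Y ⟶ Z), S.IsDeflation y → ∀ c : P ⟶ Z, ∃ b : P ⟶ Y, b ≫ y = c

def HasEnoughProjectives : Prop :=
  ∀ M : C, ∃ (K P : C) (k : K ⟶ P) (p : P ⟶ M), S.IsProjective P ∧ S.IsConflation k p

/-- A morphism is compatible if it is an isomorphism as soon as it is both an inflation and a
deflation. -/
def IsCompatible {X Y : C} (f : X ⟶ Y) : Prop :=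
  S.IsInflation f → S.IsDeflation f → IsIso f

/-- Right exact sequences `X ⟶ Y ⟶ Z`. -/
def IsRightExactSeq {X Y Z : C} (f : X ⟶ Y) (g : Y ⟶ Z) : Prop :=
  ∃ (K : C) (h₁ : X ⟶ K) (h₂ : K ⟶ Y),
    S.IsConflation h₂ g ∧ S.IsDeflation h₁ ∧ S.IsCompatible h₁ ∧ h₁ ≫ h₂ = f

/-- Left exact sequences `X ⟶ Y ⟶ Z`. -/
def IsLeftExactSeq {X Y Z : C} (f : X ⟶ Y) (g : Y ⟶ Z) : Prop :=
  ∃ (K : C) (h₁ : Y ⟶ K) (h₂ : K ⟶ Z),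
    S.IsConflation f h₁ ∧ S.IsInflation h₂ ∧ S.IsCompatible h₂ ∧ h₁ ≫ h₂ = g

/-- Right exact four-term `E`-triangle sequences `X ⟶ Y ⟶ Z ⟶ W`. -/
def IsRightExactSeq₄ {X Y Z W : C} (f : X ⟶ Y) (g : Y ⟶ Z) (h : Z ⟶ W) : Prop :=
  ∃ (K : C) (g₁ : Y ⟶ K) (g₂ : K ⟶ Z),
    S.IsConflation f g₁ ∧ S.IsConflation g₂ h ∧ g₁ ≫ g₂ = g ∧ S.IsCompatible g₁

/-- Left exact four-term `E`-triangle sequences `X ⟶ Y ⟶ Z ⟶ W`. -/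
def IsLeftExactSeq₄ {X Y Z W : C} (f : X ⟶ Y) (g : Y ⟶ Z) (h : Z ⟶ W) : Prop :=
  ∃ (K : C) (g₁ : Y ⟶ K) (g₂ : K ⟶ Z),
    S.IsConflation f g₁ ∧ S.IsConflation g₂ h ∧ g₁ ≫ g₂ = g ∧ S.IsCompatible g₂

/-- A resolving subcategory: a full additive subcategory, closed under isomorphisms, which
contains the projective objects and is closed under extensions and cocones. -/
structure IsResolving (𝒳 : ObjectProperty C) : Prop where
  of_iso : ∀ {X Y : C}, (X ≅ Y) → 𝒳 X → 𝒳 Y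
  of_isZero : ∀ {X : C}, IsZero X → 𝒳 X
  biprod : ∀ {X Y : C}, 𝒳 X → 𝒳 Y → 𝒳 (X ⊞ Y)
  of_isProjective : ∀ {P : C}, S.IsProjective P → 𝒳 P
  of_extension : ∀ {X Y Z : C} (x : X ⟶ Y) (y : Y ⟶ Z), S.IsConflation x y → 𝒳 X → 𝒳 Z → 𝒳 Y
  of_cocone : ∀ {X Y Z : C} (x : X ⟶ Y) (y : Y ⟶ Z), S.IsConflation x y → 𝒳 Y → 𝒳 Z → 𝒳 X

/-- There is an `E`-triangle sequence `0 ⟶ T n ⟶ ⋯ ⟶ T 1 ⟶ T 0 ⟶ M ⟶ 0` with all `T i` in `𝒳`.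
It is spliced from `E`-triangles `K (i + 1) ⟶ T i ⟶ K i ⇢` for `0 ≤ i ≤ n`, where `K 0` is `M` and
`K (n + 1)` is zero (the values of `T` and `K` at larger indices play no role). -/
def HasResolution (𝒳 : ObjectProperty C) (M : C) (n : ℕ) : Prop :=
  ∃ T K : ℕ → C, Nonempty (K 0 ≅ M) ∧ IsZero (K (n + 1)) ∧
    ∀ i ≤ n, 𝒳 (T i) ∧ ∃ (g : K (i + 1) ⟶ T i) (f : T i ⟶ K i), S.IsConflation g f

/-- The `𝒳`-resolution dimension of `M`; it is `⊤` if `M` has no finite `𝒳`-resolution. -/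
def resDim (𝒳 : ObjectProperty C) (M : C) : ℕ∞ :=
  ⨅ (n : ℕ) (_ : S.HasResolution 𝒳 M n), (n : ℕ∞)

/-- The supremum of the `𝒳`-resolution dimensions of the objects in a class `𝒴`. -/
def resDimOf (𝒳 𝒴 : ObjectProperty C) : ℕ∞ :=
  ⨆ (M : C) (_ : 𝒴 M), S.resDim 𝒳 M

/-- The `𝒳`-resolution dimension of the whole category. -/
def resDimCat (𝒳 : ObjectProperty C) : ℕ∞ :=
  ⨆ M : C, S.resDim 𝒳 M

end ExtriangulatedStructure

section Functors

variable {C : Type u₁} [Category.{v₁} C] [Preadditive C] [HasZeroObject C] [HasBinaryBiproducts C]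
variable {D : Type u₂} [Category.{v₂} D] [Preadditive D] [HasZeroObject D] [HasBinaryBiproducts D]
variable (S : ExtriangulatedStructure.{w₁} C) (S' : ExtriangulatedStructure.{w₂} D)

/-- Right exact functors between extriangulated categories. -/
structure IsRightExact (F : C ⥤ D) : Prop where
  additive : F.Additive
  map_compatible : ∀ {X Y : C} (f : X ⟶ Y), S.IsCompatible f → S'.IsCompatible (F.map f)
  map_seq : ∀ {X Y Z : C} (f : X ⟶ Y) (g : Y ⟶ Z),
    S.IsRightExactSeq f g → S'.IsRightExactSeq (F.map f) (F.map g)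

/-- Left exact functors between extriangulated categories. -/
structure IsLeftExact (F : C ⥤ D) : Prop where
  additive : F.Additive
  map_compatible : ∀ {X Y : C} (f : X ⟶ Y), S.IsCompatible f → S'.IsCompatible (F.map f)
  map_seq : ∀ {X Y Z : C} (f : X ⟶ Y) (g : Y ⟶ Z),
    S.IsLeftExactSeq f g → S'.IsLeftExactSeq (F.map f) (F.map g)

/-- Exact functors between extriangulated categories. -/
structure IsExact (F : C ⥤ D) : Prop where
  additive : F.Additive
  map_compatible : ∀ {X Y : C} (f : X ⟶ Y), S.IsCompatible f → S'.IsCompatible (F.map f)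
  map_conflation : ∀ {X Y Z : C} (f : X ⟶ Y) (g : Y ⟶ Z),
    S.IsConflation f g → S'.IsConflation (F.map f) (F.map g)

end Functors

/-- A recollement `(A, B, C)` of extriangulated categories. -/
structure Recollement
    {A : Type u₁} [Category.{v₁} A] [Preadditive A] [HasZeroObject A] [HasBinaryBiproducts A]
    {B : Type u₂} [Category.{v₂} B] [Preadditive B] [HasZeroObject B] [HasBinaryBiproducts B]
    {C : Type u₃} [Category.{v₃} C] [Preadditive C] [HasZeroObject C] [HasBinaryBiproducts C]
    (SA : ExtriangulatedStructure.{w₁} A) (SB : ExtriangulatedStructure.{w₂} B)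
    (SC : ExtriangulatedStructure.{w₃} C) where
  /-- `i^*` -/
  iUpperStar : B ⥤ A
  /-- `i_*` -/
  iLowerStar : A ⥤ B
  /-- `i^!` -/
  iUpperShriek : B ⥤ A
  /-- `j_!` -/
  jLowerShriek : C ⥤ B
  /-- `j^*` -/
  jUpperStar : B ⥤ C
  /-- `j_*` -/
  jLowerStar : C ⥤ B
  exact_iLowerStar : IsExact SA SB iLowerStar
  exact_jUpperStar : IsExact SB SC jUpperStar
  rightExact_iUpperStar : IsRightExact SB SA iUpperStar
  rightExact_jLowerShriek : IsRightExact SC SB jLowerShriek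
  leftExact_iUpperShriek : IsLeftExact SB SA iUpperShriek
  leftExact_jLowerStar : IsLeftExact SC SB jLowerStar
  /-- (R1): the adjoint triples `(i^*, i_*, i^!)` and `(j_!, j^*, j_*)` -/
  adj_iUpperStar : iUpperStar ⊣ iLowerStar
  adj_iUpperShriek : iLowerStar ⊣ iUpperShriek
  adj_jLowerShriek : jLowerShriek ⊣ jUpperStar
  adj_jLowerStar : jUpperStar ⊣ jLowerStar
  /-- (R2): the (essential) image of `i_*` is the kernel of `j^*` -/
  essImage_iff : ∀ X : B, iLowerStar.essImage X ↔ IsZero (jUpperStar.obj X)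
  /-- (R3) -/
  full_iLowerStar : iLowerStar.Full
  faithful_iLowerStar : iLowerStar.Faithful
  full_jLowerShriek : jLowerShriek.Full
  faithful_jLowerShriek : jLowerShriek.Faithful
  full_jLowerStar : jLowerStar.Full
  faithful_jLowerStar : jLowerStar.Faithful
  /-- (R4): the left exact sequence `i_* i^! X ⟶ X ⟶ j_* j^* X ⟶ i_* Y` -/
  exists_left : ∀ X : B, ∃ (Y : A) (h : jLowerStar.obj (jUpperStar.obj X) ⟶ iLowerStar.obj Y),
    SB.IsLeftExactSeq₄ (adj_iUpperShriek.counit.app X) (adj_jLowerStar.unit.app X) h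
  /-- (R5): the right exact sequence `i_* Y ⟶ j_! j^* X ⟶ X ⟶ i_* i^* X` -/
  exists_right : ∀ X : B, ∃ (Y : A) (h : iLowerStar.obj Y ⟶ jLowerShriek.obj (jUpperStar.obj X)),
    SB.IsRightExactSeq₄ h (adj_jLowerShriek.counit.app X) (adj_iUpperStar.unit.app X)

end

end Extri

/-! Bounded resolution length behaves as for modules. When there are enough projectives, the objects
of length at most `n` (`resLE`) are closed under extensions (`resLE_of_extension`, a horseshoe
argument), under cocones (`resLE_left`), and under cones of `X ⟶ Y` when `X` has length `n` and `Y`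
length `n + 1` (`resLE_right`). Hence an exact functor pushes resolutions forward, which settles the
bounds for `i_*` and for `j^*`.

For the middle category, every `M` is assembled from objects of `i_*(A)` and from `j_! j^* M` (or
`j_* j^* M`). The functors `j_!` and `j_*` are only one-sided exact, but the defect of exactness
dies under `j^*`: after applying `j^*`, condition (WIC) makes the compatible factor both an
inflation and a deflation, hence an isomorphism. So the defect lies in `i_*(A)`, whose lengths are
controlled, and a resolution of `j^* M` can be transported term by term. The summand `+ 1` is the
cost of the defect on the `j_!` side; on the `j_*` side there is no such cost. -/

namespace Extri

/-! ### Calculus of the extension bifunctor. -/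

section Extensions

variable {C : Type u} [Category.{v} C] (E : Cᵒᵖ ⥤ C ⥤ AddCommGrpCat.{w})

@[simp] lemma push_zero {Z X X' : C} (a : X ⟶ X') : push E a (0 : Ext E Z X) = 0 := map_zero _

@[simp] lemma pull_zero {Z Z' X : C} (c : Z' ⟶ Z) : pull E c (0 : Ext E Z X) = 0 := map_zero _

lemma push_add {Z X X' : C} (a : X ⟶ X') (δ δ' : Ext E Z X) :
    push E a (δ + δ') = push E a δ + push E a δ' := map_add _ _ _

@[simp] lemma push_id {Z X : C} (δ : Ext E Z X) : push E (𝟙 X) δ = δ := by simp [push]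

@[simp] lemma pull_id {Z X : C} (δ : Ext E Z X) : pull E (𝟙 Z) δ = δ := by simp [pull]

lemma push_comp {Z X X' X'' : C} (a : X ⟶ X') (b : X' ⟶ X'') (δ : Ext E Z X) :
    push E (a ≫ b) δ = push E b (push E a δ) := by simp [push]

lemma pull_comp {Z Z' Z'' X : C} (c : Z' ⟶ Z) (d : Z'' ⟶ Z') (δ : Ext E Z X) :
    pull E (d ≫ c) δ = pull E d (pull E c δ) := by simp [pull]

lemma push_pull {Z Z' X X' : C} (a : X ⟶ X') (c : Z' ⟶ Z) (δ : Ext E Z X) :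
    push E a (pull E c δ) = pull E c (push E a δ) := by
  simp only [push, pull]
  rw [← ConcreteCategory.comp_apply, ← ConcreteCategory.comp_apply]
  simp

end Extensions

namespace ExtriangulatedStructure

open ZeroObject

/-! ### Elementary properties of `E`-triangles. -/

variable {C : Type u} [Category.{v} C] [Preadditive C] [HasZeroObject C] [HasBinaryBiproducts C]
variable {S : ExtriangulatedStructure.{w} C}

lemma push_zero_hom {Z X X' : C} (δ : Ext S.E Z X) : push S.E (0 : X ⟶ X') δ = 0 := by
  have := S.additive_right (op Z)
  simp [push]

lemma realizes_id_left (X : C) {Z : C} (hZ : IsZero Z) :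
    S.Realizes (𝟙 X) (0 : X ⟶ Z) (0 : Ext S.E Z X) :=
  S.realizes_of_equiv (x := biprod.inl) (y := biprod.snd)
    ⟨biprod.fst, biprod.inl, by
      ext <;> simp
      exact hZ.eq_of_src _ _, by simp⟩ (by simp) (hZ.eq_of_tgt _ _) (S.realizes_zero X Z)

lemma realizes_id_right (Z : C) {X : C} (hX : IsZero X) :
    S.Realizes (0 : X ⟶ Z) (𝟙 Z) (0 : Ext S.E Z X) :=
  S.realizes_of_equiv (x := biprod.inl) (y := biprod.snd)
    ⟨biprod.snd, biprod.inr, by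
      ext <;> simp
      exact hX.eq_of_src _ _, by simp⟩ (hX.eq_of_src _ _) (by simp) (S.realizes_zero X Z)

lemma isConflation_id_right (Z : C) {X : C} (hX : IsZero X) :
    S.IsConflation (0 : X ⟶ Z) (𝟙 Z) := ⟨0, realizes_id_right Z hX⟩

lemma isConflation_id_left (X : C) {Z : C} (hZ : IsZero Z) :
    S.IsConflation (𝟙 X) (0 : X ⟶ Z) := ⟨0, realizes_id_left X hZ⟩

lemma isDeflation_id (X : C) : S.IsDeflation (𝟙 X) :=
  ⟨_, _, isConflation_id_right X (isZero_zero C)⟩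

lemma isInflation_id (X : C) : S.IsInflation (𝟙 X) :=
  ⟨_, _, isConflation_id_left X (isZero_zero C)⟩

variable {X Y Z : C} {x : X ⟶ Y} {y : Y ⟶ Z}

/-- Map the trivial triangle `X ⟶ X ⟶ 0` into the given one: `x ≫ y` then factors through `0`. -/
lemma Realizes.comp_eq_zero {δ : Ext S.E Z X} (h : S.Realizes x y δ) : x ≫ y = 0 := by
  obtain ⟨c, -, hc⟩ := S.et3 (realizes_id_left X (isZero_zero C)) h (𝟙 X) x (by simp)
  rw [← hc, zero_comp]

/-- The deflation of an `E`-triangle is a weak cokernel of its inflation. -/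
lemma Realizes.exists_desc {δ : Ext S.E Z X} (h : S.Realizes x y δ) {W : C} (ψ : Y ⟶ W)
    (hψ : x ≫ ψ = 0) : ∃ θ : Z ⟶ W, y ≫ θ = ψ := by
  obtain ⟨c, -, hc⟩ := S.et3 h (realizes_id_right W (isZero_zero C)) 0 ψ (by simp [hψ])
  exact ⟨c, by simpa using hc⟩

/-- An endomorphism of an `E`-triangle which is the identity on the ends is an isomorphism. -/
lemma Realizes.isIso_middle {δ : Ext S.E Z X} (h : S.Realizes x y δ) (φ : Y ⟶ Y)
    (hx : x ≫ φ = x) (hy : φ ≫ y = y) : IsIso φ := by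
  -- `φ - 𝟙` vanishes on `x`, so it factors through `y`, and `(φ - 𝟙) ≫ y = 0`. Hence it squares to
  -- zero and `𝟙 - (φ - 𝟙)` inverts `φ`.
  obtain ⟨θ, hθ⟩ := h.exists_desc (φ - 𝟙 Y) (by simp [hx])
  have hsq : (φ - 𝟙 Y) ≫ (φ - 𝟙 Y) = 0 := by
    nth_rw 2 [← hθ]
    rw [← Category.assoc, Preadditive.sub_comp, hy]
    simp
  have h2 : φ ≫ φ - φ - (φ - 𝟙 Y) = 0 := by
    simpa [Preadditive.sub_comp, Preadditive.comp_sub] using hsq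
  refine ⟨𝟙 Y - (φ - 𝟙 Y), ?_, ?_⟩
  · rw [Preadditive.comp_sub, Preadditive.comp_sub, Category.comp_id, ← sub_eq_zero, ← neg_eq_zero,
      ← h2]
    abel
  · rw [Preadditive.sub_comp, Preadditive.sub_comp, Category.id_comp, ← sub_eq_zero, ← neg_eq_zero,
      ← h2]
    abel

/-- Realize the transported class and lift the isomorphisms of the ends, in both directions, to the
middle terms. The two composites fix the ends, so `isIso_middle` makes the lifts invertible and
`realizes_of_equiv` applies. -/
lemma Realizes.of_iso {X' Y' Z' : C} {δ : Ext S.E Z X} (h : S.Realizes x y δ)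
    (a : X ≅ X') (b : Y ≅ Y') (c : Z ≅ Z') {x' : X' ⟶ Y'} {y' : Y' ⟶ Z'}
    (hx : x ≫ b.hom = a.hom ≫ x') (hy : y ≫ c.hom = b.hom ≫ y') :
    S.Realizes x' y' (push S.E a.hom (pull S.E c.inv δ)) := by
  obtain ⟨W, x₁, y₁, h₁⟩ := S.exists_realizes (push S.E a.hom (pull S.E c.inv δ))
  obtain ⟨f, hf₁, hf₂⟩ := S.exists_middle h h₁ a.hom c.hom (by
    rw [push_pull, ← pull_comp, Iso.hom_inv_id, pull_id])
  obtain ⟨g, hg₁, hg₂⟩ := S.exists_middle h₁ h a.inv c.inv (by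
    rw [← push_comp, Iso.hom_inv_id, push_id])
  have i₁ : IsIso (f ≫ g) := h.isIso_middle _ (by rw [reassoc_of% hf₁, hg₁]; simp)
    (by rw [Category.assoc, hg₂, reassoc_of% hf₂]; simp)
  have i₂ : IsIso (g ≫ f) := h₁.isIso_middle _ (by rw [reassoc_of% hg₁, hf₁]; simp)
    (by rw [Category.assoc, hf₂, reassoc_of% hg₂]; simp)
  have : IsIso f := by
    have : IsSplitMono f := ⟨⟨⟨g ≫ inv (f ≫ g), by rw [← Category.assoc]; simp⟩⟩⟩
    have : Epi f := epi_of_epi g f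
    exact isIso_of_epi_of_isSplitMono f
  refine S.realizes_of_equiv ((asIso f).symm ≪≫ b) ?_ ?_ h₁
  · rw [← cancel_epi a.hom, ← hx, ← Category.assoc, ← hf₁]
    simp
  · simp [← hy, ← hf₂]

lemma IsConflation.of_iso {X' Y' Z' : C} (h : S.IsConflation x y)
    (a : X ≅ X') (b : Y ≅ Y') (c : Z ≅ Z') {x' : X' ⟶ Y'} {y' : Y' ⟶ Z'}
    (hx : x ≫ b.hom = a.hom ≫ x') (hy : y ≫ c.hom = b.hom ≫ y') : S.IsConflation x' y' :=
  let ⟨_, hδ⟩ := h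
  ⟨_, hδ.of_iso a b c hx hy⟩

lemma IsInflation.of_iso {X' Y' : C} (h : S.IsInflation x) (a : X ≅ X') (b : Y ≅ Y')
    {x' : X' ⟶ Y'} (hx : x ≫ b.hom = a.hom ≫ x') : S.IsInflation x' := by
  obtain ⟨Z, y, h⟩ := h
  exact ⟨Z, b.inv ≫ y, h.of_iso a b (Iso.refl Z) hx (by simp)⟩

lemma IsDeflation.of_iso {Y' Z' : C} (h : S.IsDeflation y) (b : Y ≅ Y') (c : Z ≅ Z')
    {y' : Y' ⟶ Z'} (hy : y ≫ c.hom = b.hom ≫ y') : S.IsDeflation y' := by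
  obtain ⟨X, x, h⟩ := h
  exact ⟨X, x ≫ b.hom, h.of_iso (Iso.refl X) b c (by simp) hy⟩

/-- An `E`-triangle whose deflation has a section is the trivial one. -/
lemma Realizes.eq_zero_of_section {δ : Ext S.E Z X} (h : S.Realizes x y δ) (s : Z ⟶ Y)
    (hs : s ≫ y = 𝟙 Z) : δ = 0 := by
  obtain ⟨a, ha, -⟩ := S.et3_op (S.realizes_zero X Z) h (biprod.desc x s) (𝟙 Z) (by
    ext <;> simp [h.comp_eq_zero, hs])
  simpa using ha.symm

lemma IsConflation.exists_iso_biprod (h : S.IsConflation x y) (s : Z ⟶ Y) (hs : s ≫ y = 𝟙 Z) :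
    ∃ b : X ⊞ Z ≅ Y, biprod.inl ≫ b.hom = x ∧ b.hom ≫ y = biprod.snd := by
  obtain ⟨δ, h⟩ := h
  obtain rfl := h.eq_zero_of_section s hs
  exact S.realizes_unique (S.realizes_zero X Z) h

lemma IsConflation.isZero_of_isIso (h : S.IsConflation x y) [IsIso y] : IsZero X := by
  obtain ⟨b, hb₁, hb₂⟩ := h.exists_iso_biprod (inv y) (by simp)
  obtain ⟨δ, h⟩ := h
  have hx : x = 0 := by
    rw [← cancel_mono y, h.comp_eq_zero, zero_comp]
  have : (biprod.inl : X ⟶ X ⊞ Z) = 0 := by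
    rw [← cancel_mono b.hom, hb₁, hx, zero_comp]
  rw [IsZero.iff_id_eq_zero, ← biprod.inl_fst (X := X) (Y := Z), this, zero_comp]

lemma IsConflation.isZero_right_of_isIso (h : S.IsConflation x y) [IsIso x] : IsZero Z := by
  obtain ⟨δ, h⟩ := h
  have hy : y = 0 := by
    rw [← cancel_epi x, h.comp_eq_zero, comp_zero]
  have hδ : δ = 0 := by
    obtain ⟨c, hc, -⟩ := S.et3 h (realizes_id_left X (isZero_zero C)) (𝟙 X) (inv x) (by simp)
    simpa using hc
  subst hδ
  obtain ⟨b, -, hb⟩ := S.realizes_unique (S.realizes_zero X Z) h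
  have : (biprod.snd : X ⊞ Z ⟶ Z) = 0 := by rw [← hb, hy, comp_zero]
  rw [IsZero.iff_id_eq_zero, ← biprod.inr_snd (X := X) (Y := Z), this, comp_zero]

lemma IsConflation.isIso_of_isZero (h : S.IsConflation x y) (hX : IsZero X) : IsIso y := by
  obtain ⟨δ, h⟩ := h
  have hδ : δ = 0 := by
    rw [← push_id S.E δ, hX.eq_of_src (𝟙 X) 0, push_zero_hom]
  subst hδ
  obtain ⟨b, -, hb⟩ := S.realizes_unique h (realizes_id_right Z hX)
  rw [Category.comp_id] at hb
  rw [← hb]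
  infer_instance

/-- The `E`-triangles of a composition of deflations. -/
lemma IsConflation.exists_comp {X₁ X₂ X₃ D F : C} {f' : D ⟶ X₁} {f : X₁ ⟶ X₂} {g' : F ⟶ X₂}
    {g : X₂ ⟶ X₃} (hf : S.IsConflation f' f) (hg : S.IsConflation g' g) :
    ∃ (Q : C) (h' : Q ⟶ X₁) (d : D ⟶ Q) (e : Q ⟶ F),
      S.IsConflation h' (f ≫ g) ∧ S.IsConflation d e := by
  obtain ⟨_, hf⟩ := hf
  obtain ⟨_, hg⟩ := hg
  obtain ⟨Q, h', d, e, _, -, -, h₁, h₂, -, -⟩ := S.et4_op hf hg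
  exact ⟨Q, h', d, e, ⟨_, h₁⟩, ⟨_, h₂⟩⟩

/-- Two `E`-triangles with the same third term fit into a common diagram. -/
lemma IsConflation.exists_pullback {X₁ Y₁ X₂ Y₂ : C} {x₁ : X₁ ⟶ Y₁} {y₁ : Y₁ ⟶ Z} {x₂ : X₂ ⟶ Y₂}
    {y₂ : Y₂ ⟶ Z} (h₁ : S.IsConflation x₁ y₁) (h₂ : S.IsConflation x₂ y₂) :
    ∃ (M : C) (m₁ : X₁ ⟶ M) (e₁ : M ⟶ Y₂) (m₂ : X₂ ⟶ M) (e₂ : M ⟶ Y₁),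
      S.IsConflation m₁ e₁ ∧ S.IsConflation m₂ e₂ := by
  obtain ⟨δ₁, h₁⟩ := h₁
  obtain ⟨δ₂, h₂⟩ := h₂
  -- `M` realizes the class with components `δ₁` and `δ₂`. Dividing out `X₂` or `X₁` by (ET4) leaves
  -- a realization of `δ₁` or `δ₂`, so the quotients of `M` are `Y₁` and `Y₂`.
  obtain ⟨M, m, e, hm⟩ := S.exists_realizes
    (push S.E (biprod.inl : X₁ ⟶ X₁ ⊞ X₂) δ₁ + push S.E (biprod.inr : X₂ ⟶ X₁ ⊞ X₂) δ₂)
  obtain ⟨Q₁, p₁, d₁, e₁, ε₁, -, -, hp₁, hd₁, -, -⟩ :=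
    S.et4 (realizes_of_equiv S (biprod.braiding X₂ X₁) (x' := biprod.inr) (y' := biprod.fst)
      (by ext <;> simp) (by simp) (S.realizes_zero X₂ X₁)) hm
  obtain ⟨Q₂, p₂, d₂, e₂, ε₂, -, -, hp₂, hd₂, -, -⟩ := S.et4 (S.realizes_zero X₁ X₂) hm
  rw [push_add, ← push_comp, ← push_comp, biprod.inl_fst, biprod.inr_fst, push_id, push_zero_hom,
    add_zero] at hd₁
  rw [push_add, ← push_comp, ← push_comp, biprod.inl_snd, biprod.inr_snd, push_id, push_zero_hom,
    zero_add] at hd₂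
  obtain ⟨b₁, -, -⟩ := S.realizes_unique hd₁ h₁
  obtain ⟨b₂, -, -⟩ := S.realizes_unique hd₂ h₂
  exact ⟨M, biprod.inl ≫ m, p₂ ≫ b₂.hom, biprod.inr ≫ m, p₁ ≫ b₁.hom,
    IsConflation.of_iso ⟨_, hp₂⟩ (Iso.refl _) (Iso.refl _) b₂ (by simp) (by simp),
    IsConflation.of_iso ⟨_, hp₁⟩ (Iso.refl _) (Iso.refl _) b₁ (by simp) (by simp)⟩

variable (S) in
/-- The objects `M` with an `E`-triangle sequence `0 ⟶ T n ⟶ ⋯ ⟶ T 0 ⟶ M ⟶ 0` with terms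
in `𝒳`, described recursively. -/
def resLE (𝒳 : ObjectProperty C) : ℕ → ObjectProperty C
  | 0 => 𝒳
  | n + 1 => fun M => ∃ (K T : C) (g : K ⟶ T) (f : T ⟶ M),
      S.IsConflation g f ∧ 𝒳 T ∧ resLE 𝒳 n K

/-! ### Closure properties of bounded resolution length. -/

variable {𝒳 : ObjectProperty C}

lemma IsResolving.resLE_of_iso (h𝒳 : S.IsResolving 𝒳) {n : ℕ} {M M' : C} (e : M ≅ M')
    (hM : S.resLE 𝒳 n M) : S.resLE 𝒳 n M' := by
  cases n with
  | zero => exact h𝒳.of_iso e hM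
  | succ n =>
    obtain ⟨K, T, g, f, h, hT, hK⟩ := hM
    exact ⟨K, T, g, f ≫ e.hom, h.of_iso (Iso.refl _) (Iso.refl _) e (by simp) (by simp), hT, hK⟩

lemma IsResolving.resLE_of_mem (h𝒳 : S.IsResolving 𝒳) (n : ℕ) {M : C} (hM : 𝒳 M) :
    S.resLE 𝒳 n M := by
  induction n generalizing M with
  | zero => exact hM
  | succ n ih =>
    exact ⟨0, M, 0, 𝟙 M, isConflation_id_right M (isZero_zero C), hM,
      ih (h𝒳.of_isZero (isZero_zero C))⟩

lemma IsResolving.resLE_succ (h𝒳 : S.IsResolving 𝒳) {n : ℕ} {M : C} (hM : S.resLE 𝒳 n M) :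
    S.resLE 𝒳 (n + 1) M := by
  induction n generalizing M with
  | zero => exact h𝒳.resLE_of_mem 1 hM
  | succ n ih =>
    obtain ⟨K, T, g, f, h, hT, hK⟩ := hM
    exact ⟨K, T, g, f, h, hT, ih hK⟩

lemma IsResolving.resLE_mono (h𝒳 : S.IsResolving 𝒳) {m n : ℕ} (hmn : m ≤ n) {M : C}
    (hM : S.resLE 𝒳 m M) : S.resLE 𝒳 n M := by
  induction n, hmn using Nat.le_induction with
  | base => exact hM
  | succ n _ ih => exact h𝒳.resLE_succ ih

/-- Horseshoe argument. The first term over `Z` need not lift to `Y`, so it is replaced by a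
projective `P`. The pullback `M` of `Y` and `P` over `Z` then splits as `X ⊞ P`, and `TX ⊞ P ⟶ M ⟶
Y` starts a resolution of `Y`. -/
lemma IsResolving.resLE_of_extension (h𝒳 : S.IsResolving 𝒳) (hP : S.HasEnoughProjectives) {n : ℕ}
    {X Y Z : C} {x : X ⟶ Y} {y : Y ⟶ Z} (h : S.IsConflation x y) (hX : S.resLE 𝒳 n X)
    (hZ : S.resLE 𝒳 n Z) : S.resLE 𝒳 n Y := by
  induction n generalizing X Y Z with
  | zero => exact h𝒳.of_extension x y h hX hZ
  | succ n ih =>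
    obtain ⟨L, T, l, t, hT, hT𝒳, hL⟩ := hZ
    obtain ⟨R, P, r, p, hPP, hRP⟩ := hP T
    obtain ⟨K, k, d, e, hK, hde⟩ := hRP.exists_comp hT
    -- `K` is an extension of `L` by `R`, and `R` is in `𝒳` as the cocone of `P ⟶ T`.
    have hKn : S.resLE 𝒳 n K := ih hde
      (h𝒳.resLE_of_mem n (h𝒳.of_cocone r p hRP (h𝒳.of_isProjective hPP) hT𝒳)) hL
    obtain ⟨M, m₁, e₁, m₂, e₂, hm₁, hm₂⟩ := h.exists_pullback hK
    obtain ⟨s, hs⟩ := hPP e₁ ⟨_, _, hm₁⟩ (𝟙 P)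
    obtain ⟨b, -, -⟩ := hm₁.exists_iso_biprod s hs
    obtain ⟨KX, TX, g, f, ⟨δ, hgf⟩, hTX, hKX⟩ := hX
    have hbp : S.IsConflation (biprod.map g (0 : (0 : C) ⟶ P)) (biprod.map f (𝟙 P) ≫ b.hom) :=
      IsConflation.of_iso ⟨_, S.realizes_biprod hgf (realizes_id_right P (isZero_zero C))⟩
        (Iso.refl _) (Iso.refl _) b (by simp) (by simp)
    obtain ⟨Q, q, d', e', hQ, hde'⟩ := hbp.exists_comp hm₂
    exact ⟨Q, _, q, _, hQ, h𝒳.biprod hTX (h𝒳.of_isProjective hPP),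
      ih hde' (h𝒳.resLE_of_iso (isoBiprodZero (isZero_zero C)) hKX) hKn⟩

/-- The cocone of `T ⟶ Y ⟶ Z` is an extension of `X` by the first syzygy of `Y`. -/
lemma IsResolving.resLE_right (h𝒳 : S.IsResolving 𝒳) (hP : S.HasEnoughProjectives) {n : ℕ}
    {X Y Z : C} {x : X ⟶ Y} {y : Y ⟶ Z} (h : S.IsConflation x y) (hX : S.resLE 𝒳 n X)
    (hY : S.resLE 𝒳 (n + 1) Y) : S.resLE 𝒳 (n + 1) Z := by
  obtain ⟨K, T, g, f, hgf, hT, hK⟩ := hY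
  obtain ⟨Q, q, d, e, hQ, hde⟩ := hgf.exists_comp h
  exact ⟨Q, T, q, _, hQ, hT, h𝒳.resLE_of_extension hP hde hK hX⟩

lemma IsResolving.resLE_left_of_mem (h𝒳 : S.IsResolving 𝒳) {n : ℕ}
    {X Y Z : C} {x : X ⟶ Y} {y : Y ⟶ Z} (h : S.IsConflation x y) (hY : S.resLE 𝒳 n Y)
    (hZ : 𝒳 Z) : S.resLE 𝒳 n X := by
  cases n with
  | zero => exact h𝒳.of_cocone x y h hY hZ
  | succ n =>
    obtain ⟨K, T, g, f, hgf, hT, hK⟩ := hY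
    obtain ⟨Q, q, d, e, hQ, hde⟩ := hgf.exists_comp h
    exact ⟨K, Q, d, e, hde, h𝒳.of_cocone _ _ hQ hT hZ, hK⟩

/-- Pull `Y` back along `T ⟶ Z`: the result is an extension of `Y` by the syzygy of `Z`, and `X` is
its cocone over `T`, which lies in `𝒳`. -/
lemma IsResolving.resLE_left (h𝒳 : S.IsResolving 𝒳) (hP : S.HasEnoughProjectives) {n : ℕ}
    {X Y Z : C} {x : X ⟶ Y} {y : Y ⟶ Z} (h : S.IsConflation x y) (hY : S.resLE 𝒳 n Y)
    (hZ : S.resLE 𝒳 n Z) : S.resLE 𝒳 n X := by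
  cases n with
  | zero => exact h𝒳.of_cocone x y h hY hZ
  | succ n =>
    obtain ⟨K, T, g, f, hgf, hT, hK⟩ := hZ
    obtain ⟨M, m₁, e₁, m₂, e₂, hm₁, hm₂⟩ := h.exists_pullback hgf
    exact h𝒳.resLE_left_of_mem hm₁ (h𝒳.resLE_of_extension hP hm₂ (h𝒳.resLE_succ hK) hY) hT

/-! ### Comparison with the numerical resolution dimension. -/

lemma IsResolving.hasResolution_iff (h𝒳 : S.IsResolving 𝒳) {n : ℕ} {M : C} :
    S.HasResolution 𝒳 M n ↔ S.resLE 𝒳 n M := by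
  induction n generalizing M with
  | zero =>
    constructor
    · rintro ⟨T, K, ⟨e⟩, hK, h⟩
      obtain ⟨hT, g, f, hgf⟩ := h 0 le_rfl
      have := hgf.isIso_of_isZero hK
      exact h𝒳.of_iso (asIso f ≪≫ e) hT
    · intro hM
      refine ⟨fun _ => M, fun i => Nat.casesOn i M fun _ => 0, ⟨Iso.refl M⟩, isZero_zero C, ?_⟩
      rintro i hi
      obtain rfl : i = 0 := by omega
      exact ⟨hM, 0, 𝟙 M, isConflation_id_right M (isZero_zero C)⟩
  | succ n ih =>
    constructor
    · rintro ⟨T, K, ⟨e⟩, hK, h⟩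
      obtain ⟨hT, g, f, hgf⟩ := h 0 (Nat.zero_le _)
      exact h𝒳.resLE_of_iso e ⟨K 1, T 0, g, f, hgf, hT, ih.1
        ⟨fun i => T (i + 1), fun i => K (i + 1), ⟨Iso.refl _⟩, hK, fun i hi => h (i + 1) (by omega)⟩⟩
    · rintro ⟨L, T₀, g, f, hgf, hT₀, hL⟩
      obtain ⟨T, K, ⟨e⟩, hK, h⟩ := ih.2 hL
      refine ⟨fun i => Nat.casesOn i T₀ T, fun i => Nat.casesOn i M K, ⟨Iso.refl _⟩, hK, ?_⟩
      rintro (_ | i) hi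
      · exact ⟨hT₀, e.hom ≫ g, f,
          hgf.of_iso e.symm (Iso.refl _) (Iso.refl _) (by simp) (by simp)⟩
      · exact h i (by omega)

lemma IsResolving.resDim_le_iff (h𝒳 : S.IsResolving 𝒳) {n : ℕ} {M : C} :
    S.resDim 𝒳 M ≤ n ↔ S.resLE 𝒳 n M := by
  constructor
  · intro h
    by_contra hM
    have : ((n + 1 : ℕ) : ℕ∞) ≤ S.resDim 𝒳 M := le_iInf₂ fun m hm => by
      rw [Nat.cast_le]
      by_contra hlt
      exact hM (h𝒳.resLE_mono (by omega) (h𝒳.hasResolution_iff.1 hm))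
    have := this.trans h
    rw [Nat.cast_le] at this
    omega
  · exact fun h => iInf₂_le n (h𝒳.hasResolution_iff.2 h)

lemma IsResolving.resDimOf_le_iff (h𝒳 : S.IsResolving 𝒳) {n : ℕ} {𝒴 : ObjectProperty C} :
    S.resDimOf 𝒳 𝒴 ≤ n ↔ ∀ M, 𝒴 M → S.resLE 𝒳 n M := by
  simp only [resDimOf, iSup_le_iff, h𝒳.resDim_le_iff]

lemma IsResolving.resDimCat_le_iff (h𝒳 : S.IsResolving 𝒳) {n : ℕ} :
    S.resDimCat 𝒳 ≤ n ↔ ∀ M, S.resLE 𝒳 n M := by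
  simp only [resDimCat, iSup_le_iff, h𝒳.resDim_le_iff]

lemma IsResolving.resDimOf_eq_zero (h𝒳 : S.IsResolving 𝒳) {𝒴 : ObjectProperty C} (h : 𝒴 ≤ 𝒳) :
    S.resDimOf 𝒳 𝒴 = 0 :=
  nonpos_iff_eq_zero.1 (h𝒳.resDimOf_le_iff (n := 0).2 h)

end ExtriangulatedStructure

section Functors

variable {C : Type u₁} [Category.{v₁} C] [Preadditive C] [HasZeroObject C] [HasBinaryBiproducts C]
variable {D : Type u₂} [Category.{v₂} D] [Preadditive D] [HasZeroObject D] [HasBinaryBiproducts D]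
variable {S : ExtriangulatedStructure.{w₁} C} {S' : ExtriangulatedStructure.{w₂} D}
variable {F : C ⥤ D} {𝒳 : ObjectProperty C} {𝒳' : ObjectProperty D}

/-- An exact functor maps resolutions to resolutions. -/
lemma IsExact.resLE_map (hF : IsExact S S' F) (h𝒳' : S'.IsResolving 𝒳')
    (hP : S'.HasEnoughProjectives) {b : ℕ} (hb : ∀ M, 𝒳 M → S'.resLE 𝒳' b (F.obj M)) {n : ℕ} {M : C}
    (hM : S.resLE 𝒳 n M) : S'.resLE 𝒳' (n + b) (F.obj M) := by
  induction n generalizing M with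
  | zero => simpa using hb M hM
  | succ n ih =>
    obtain ⟨K, T, g, f, hgf, hT, hK⟩ := hM
    rw [Nat.add_right_comm]
    exact h𝒳'.resLE_right hP (hF.map_conflation g f hgf) (ih hK)
      (h𝒳'.resLE_mono (by omega) (hb T hT))

end Functors

/-! ### Defects of exactness of `j_!` and `j_*`. -/

namespace Recollement

variable {A : Type u₁} [Category.{v₁} A] [Preadditive A] [HasZeroObject A] [HasBinaryBiproducts A]
variable {B : Type u₂} [Category.{v₂} B] [Preadditive B] [HasZeroObject B] [HasBinaryBiproducts B]
variable {C : Type u₃} [Category.{v₃} C] [Preadditive C] [HasZeroObject C] [HasBinaryBiproducts C]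
variable {SA : ExtriangulatedStructure.{w₁} A} {SB : ExtriangulatedStructure.{w₂} B}
variable {SC : ExtriangulatedStructure.{w₃} C} (R : Recollement SA SB SC)

/-- `j_!` sends an `E`-triangle to a right exact sequence whose defect lies in the image
of `i_*`. -/
lemma exists_jLowerShriek (hC : SC.WIC) {K T M : C} {g : K ⟶ T} {f : T ⟶ M}
    (h : SC.IsConflation g f) :
    ∃ (N L : B) (n : N ⟶ R.jLowerShriek.obj K) (l : R.jLowerShriek.obj K ⟶ L)
      (k : L ⟶ R.jLowerShriek.obj T), SB.IsConflation n l ∧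
        SB.IsConflation k (R.jLowerShriek.map f) ∧ R.iLowerStar.essImage N := by
  have := R.full_jLowerShriek
  have := R.faithful_jLowerShriek
  obtain ⟨L, l, k, hk, ⟨N, n, hn⟩, hl, hlk⟩ := R.rightExact_jLowerShriek.map_seq g f
    ⟨K, 𝟙 K, g, h, ExtriangulatedStructure.isDeflation_id K, fun _ _ => inferInstance, by simp⟩
  refine ⟨N, L, n, l, k, hn, hk, (R.essImage_iff N).2 ?_⟩
  have hn' := R.exact_jUpperStar.map_conflation _ _ hn
  -- `j^* j_!` is isomorphic to the identity, so this composite is `g` up to isomorphism. By (WIC)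
  -- its first factor is an inflation; it is also a deflation and compatible, hence invertible, so
  -- `j^* N = 0`.
  have hinf : SC.IsInflation (R.jUpperStar.map l ≫ R.jUpperStar.map k) := by
    rw [← Functor.map_comp, hlk]
    exact ExtriangulatedStructure.IsInflation.of_iso ⟨_, _, h⟩
      (asIso (R.adj_jLowerShriek.unit.app K)) (asIso (R.adj_jLowerShriek.unit.app T))
      (R.adj_jLowerShriek.unit.naturality g)
  have : IsIso (R.jUpperStar.map l) := R.exact_jUpperStar.map_compatible l hl
    (hC.inflation_of_comp _ _ hinf) ⟨_, _, hn'⟩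
  exact hn'.isZero_of_isIso

/-- `j_*` sends an `E`-triangle to a left exact sequence whose defect lies in the image
of `i_*`. -/
lemma exists_jLowerStar (hC : SC.WIC) {K T M : C} {g : K ⟶ T} {f : T ⟶ M}
    (h : SC.IsConflation g f) :
    ∃ (L N : B) (k : R.jLowerStar.obj T ⟶ L) (l : L ⟶ R.jLowerStar.obj M)
      (n : R.jLowerStar.obj M ⟶ N), SB.IsConflation (R.jLowerStar.map g) k ∧
        SB.IsConflation l n ∧ R.iLowerStar.essImage N := by
  have := R.full_jLowerStar
  have := R.faithful_jLowerStar
  obtain ⟨L, k, l, hk, ⟨N, n, hn⟩, hl, hkl⟩ := R.leftExact_jLowerStar.map_seq g f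
    ⟨M, f, 𝟙 M, h, ExtriangulatedStructure.isInflation_id M, fun _ _ => inferInstance, by simp⟩
  refine ⟨L, N, k, l, n, hk, hn, (R.essImage_iff N).2 ?_⟩
  have hn' := R.exact_jUpperStar.map_conflation _ _ hn
  have hdef : SC.IsDeflation (R.jUpperStar.map k ≫ R.jUpperStar.map l) := by
    rw [← Functor.map_comp, hkl]
    exact ExtriangulatedStructure.IsDeflation.of_iso ⟨_, _, h⟩
      (asIso (R.adj_jLowerStar.counit.app T)).symm (asIso (R.adj_jLowerStar.counit.app M)).symm
      (by
        rw [← cancel_epi (R.adj_jLowerStar.counit.app T),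
          ← cancel_mono (R.adj_jLowerStar.counit.app M)]
        simp)
  have : IsIso (R.jUpperStar.map l) := R.exact_jUpperStar.map_compatible l hl
    ⟨_, _, hn'⟩ (hC.deflation_of_comp _ _ hdef)
  exact hn'.isZero_right_of_isIso

/-! ### Transport of resolutions through the recollement. -/

variable {XB : ObjectProperty B} {XC : ObjectProperty C}

/-- Two applications of `resLE_right`. The first requires the defect `N` to be one step shorter than
`j_! K`, already when `n = 0`; this forces `c + 1` instead of `c`. -/
lemma resLE_jLowerShriek (hC : SC.WIC) (hXB : SB.IsResolving XB) (hP : SB.HasEnoughProjectives)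
    {c : ℕ} (hA : ∀ N, R.iLowerStar.essImage N → SB.resLE XB c N)
    (hX : ∀ M, XC M → SB.resLE XB (c + 1) (R.jLowerShriek.obj M)) {n : ℕ} {M : C}
    (hM : SC.resLE XC n M) : SB.resLE XB (n + (c + 1)) (R.jLowerShriek.obj M) := by
  induction n generalizing M with
  | zero => simpa using hX M hM
  | succ n ih =>
    obtain ⟨K, T, g, f, hgf, hT, hK⟩ := hM
    obtain ⟨N, L, _, _, _, hNL, hL, hN⟩ := R.exists_jLowerShriek hC hgf
    have hL' : SB.resLE XB (n + c + 1) L :=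
      hXB.resLE_right hP hNL (hXB.resLE_mono (by omega) (hA N hN)) (ih hK)
    exact hXB.resLE_mono (by omega) (hXB.resLE_right hP hL hL'
      (hXB.resLE_mono (by omega) (hX T hT)))

/-- Here the defect `N` is the cone of `L ⟶ j_* M`, so closure under extensions absorbs it and no
extra `1` appears. -/
lemma resLE_jLowerStar (hC : SC.WIC) (hXB : SB.IsResolving XB) (hP : SB.HasEnoughProjectives)
    {c : ℕ} (hA : ∀ N, R.iLowerStar.essImage N → SB.resLE XB c N)
    (hX : ∀ M, XC M → SB.resLE XB c (R.jLowerStar.obj M)) {n : ℕ} {M : C}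
    (hM : SC.resLE XC n M) : SB.resLE XB (n + c) (R.jLowerStar.obj M) := by
  induction n generalizing M with
  | zero => simpa using hX M hM
  | succ n ih =>
    obtain ⟨K, T, g, f, hgf, hT, hK⟩ := hM
    obtain ⟨L, N, _, _, _, hL, hLN, hN⟩ := R.exists_jLowerStar hC hgf
    have hL' : SB.resLE XB (n + c + 1) L :=
      hXB.resLE_right hP hL (ih hK) (hXB.resLE_mono (by omega) (hX T hT))
    exact hXB.resLE_of_extension hP hLN (hXB.resLE_mono (by omega) hL')
      (hXB.resLE_mono (by omega) (hA N hN))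

/-- By (R5), `M` is an extension of `i_* i^* M` by the cone of `i_* Y ⟶ j_! j^* M`. -/
lemma resLE_of_jLowerShriek (hC : SC.WIC) (hXB : SB.IsResolving XB)
    (hP : SB.HasEnoughProjectives) {c n : ℕ} (hA : ∀ N, R.iLowerStar.essImage N → SB.resLE XB c N)
    (hX : ∀ M, XC M → SB.resLE XB (c + 1) (R.jLowerShriek.obj M))
    (hn : ∀ M, SC.resLE XC n M) (M : B) : SB.resLE XB (n + c + 1) M := by
  obtain ⟨Y, h, K, g₁, g₂, h₁, h₂, -, -⟩ := R.exists_right M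
  refine hXB.resLE_of_extension hP h₂ ?_
    (hXB.resLE_mono (by omega) (hA _ (R.iLowerStar.obj_mem_essImage _)))
  exact hXB.resLE_right hP h₁ (hXB.resLE_mono (by omega) (hA _ (R.iLowerStar.obj_mem_essImage _)))
    (R.resLE_jLowerShriek hC hXB hP hA hX (hn _))

/-- By (R4), `M` is an extension of the cocone of `j_* j^* M ⟶ i_* Y` by `i_* i^! M`. -/
lemma resLE_of_jLowerStar (hC : SC.WIC) (hXB : SB.IsResolving XB)
    (hP : SB.HasEnoughProjectives) {c n : ℕ} (hA : ∀ N, R.iLowerStar.essImage N → SB.resLE XB c N)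
    (hX : ∀ M, XC M → SB.resLE XB c (R.jLowerStar.obj M))
    (hn : ∀ M, SC.resLE XC n M) (M : B) : SB.resLE XB (n + c) M := by
  obtain ⟨Y, h, K, g₁, g₂, h₁, h₂, -, -⟩ := R.exists_left M
  refine hXB.resLE_of_extension hP h₁
    (hXB.resLE_mono (by omega) (hA _ (R.iLowerStar.obj_mem_essImage _))) ?_
  exact hXB.resLE_left hP h₂ (R.resLE_jLowerStar hC hXB hP hA hX (hn _))
    (hXB.resLE_mono (by omega) (hA _ (R.iLowerStar.obj_mem_essImage _)))

lemma essImage_le_map_top {N : B} (hN : R.iLowerStar.essImage N) :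
    ObjectProperty.map ⊤ R.iLowerStar N := by
  obtain ⟨Y, ⟨e⟩⟩ := hN
  exact ⟨Y, trivial, ⟨e⟩⟩

/-- The bound for the middle category in terms of `i_*` and `j_!`. -/
theorem resDimCat_le_shriek (hC : SC.WIC) (hP : SB.HasEnoughProjectives) (hXB : SB.IsResolving XB)
    (hXC : SC.IsResolving XC) :
    SB.resDimCat XB ≤ SC.resDimCat XC +
      max (SB.resDimOf XB (ObjectProperty.map ⊤ R.iLowerStar))
        (SB.resDimOf XB (XC.map R.jLowerShriek)) + 1 := by
  -- If a term on the right is infinite there is nothing to prove; otherwise the terms are natural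
  -- numbers.
  rcases eq_or_ne (SC.resDimCat XC) ⊤ with h₁ | h₁
  · simp [h₁]
  obtain ⟨n, h₁⟩ := ENat.ne_top_iff_exists.1 h₁
  rcases eq_or_ne (max (SB.resDimOf XB (ObjectProperty.map ⊤ R.iLowerStar))
        (SB.resDimOf XB (XC.map R.jLowerShriek))) ⊤ with h₂ | h₂
  · simp [h₂]
  obtain ⟨c, h₂⟩ := ENat.ne_top_iff_exists.1 h₂
  have hc := max_le_iff.1 h₂.ge
  rw [← h₁, ← h₂]
  have h := hXB.resDimCat_le_iff.2 (R.resLE_of_jLowerShriek hC hXB hP (c := c) (n := n)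
    (fun N hN => hXB.resDimOf_le_iff.1 hc.1 N (R.essImage_le_map_top hN))
    (fun M hM => hXB.resLE_succ (hXB.resDimOf_le_iff.1 hc.2 _ ⟨M, hM, ⟨Iso.refl _⟩⟩))
    (hXC.resDimCat_le_iff.1 h₁.ge))
  exact_mod_cast h

/-- The bound for the middle category in terms of `i_*`, when `j_*` preserves the resolving
subcategories. -/
theorem resDimCat_le_star (hC : SC.WIC) (hP : SB.HasEnoughProjectives) (hXB : SB.IsResolving XB)
    (hXC : SC.IsResolving XC) (hX : XC.map R.jLowerStar ≤ XB) :
    SB.resDimCat XB ≤ SC.resDimCat XC +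
      SB.resDimOf XB (ObjectProperty.map ⊤ R.iLowerStar) := by
  rcases eq_or_ne (SC.resDimCat XC) ⊤ with h₁ | h₁
  · simp [h₁]
  obtain ⟨n, h₁⟩ := ENat.ne_top_iff_exists.1 h₁
  rcases eq_or_ne (SB.resDimOf XB (ObjectProperty.map ⊤ R.iLowerStar)) ⊤ with h₂ | h₂
  · simp [h₂]
  obtain ⟨c, h₂⟩ := ENat.ne_top_iff_exists.1 h₂
  rw [← h₁, ← h₂]
  have h := hXB.resDimCat_le_iff.2 (R.resLE_of_jLowerStar hC hXB hP (c := c) (n := n)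
    (fun N hN => hXB.resDimOf_le_iff.1 h₂.ge N (R.essImage_le_map_top hN))
    (fun M hM => hXB.resLE_of_mem c (hX _ ⟨M, hM, ⟨Iso.refl _⟩⟩))
    (hXC.resDimCat_le_iff.1 h₁.ge))
  exact_mod_cast h

theorem resDimOf_iLowerStar_le {XA : ObjectProperty A} (hP : SB.HasEnoughProjectives)
    (hXA : SA.IsResolving XA) (hXB : SB.IsResolving XB) :
    SB.resDimOf XB (ObjectProperty.map ⊤ R.iLowerStar) ≤
      SA.resDimCat XA + SB.resDimOf XB (XA.map R.iLowerStar) := by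
  rcases eq_or_ne (SA.resDimCat XA) ⊤ with h₁ | h₁
  · simp [h₁]
  obtain ⟨n, h₁⟩ := ENat.ne_top_iff_exists.1 h₁
  rcases eq_or_ne (SB.resDimOf XB (XA.map R.iLowerStar)) ⊤ with h₂ | h₂
  · simp [h₂]
  obtain ⟨c, h₂⟩ := ENat.ne_top_iff_exists.1 h₂
  rw [← h₁, ← h₂]
  have h : SB.resDimOf XB (ObjectProperty.map ⊤ R.iLowerStar) ≤ (n + c : ℕ) := by
    rw [hXB.resDimOf_le_iff]
    rintro _ ⟨M, -, ⟨e⟩⟩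
    exact hXB.resLE_of_iso e (R.exact_iLowerStar.resLE_map hXB hP
      (fun M hM => hXB.resDimOf_le_iff.1 h₂.ge _ ⟨M, hM, ⟨Iso.refl _⟩⟩)
      (hXA.resDimCat_le_iff.1 h₁.ge M))
  exact_mod_cast h

/-- Every `M` is isomorphic to `j^* j_! M`, so the exact functor `j^*` carries a resolution of `j_!
M` to `M`. -/
theorem resDimCat_le_jUpperStar (hP : SC.HasEnoughProjectives)
    (hXB : SB.IsResolving XB) (hXC : SC.IsResolving XC) :
    SC.resDimCat XC ≤ SB.resDimCat XB + SC.resDimOf XC (XB.map R.jUpperStar) := by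
  rcases eq_or_ne (SB.resDimCat XB) ⊤ with h₁ | h₁
  · simp [h₁]
  obtain ⟨n, h₁⟩ := ENat.ne_top_iff_exists.1 h₁
  rcases eq_or_ne (SC.resDimOf XC (XB.map R.jUpperStar)) ⊤ with h₂ | h₂
  · simp [h₂]
  obtain ⟨c, h₂⟩ := ENat.ne_top_iff_exists.1 h₂
  have := R.full_jLowerShriek
  have := R.faithful_jLowerShriek
  rw [← h₁, ← h₂]
  have h : SC.resDimCat XC ≤ (n + c : ℕ) := by
    rw [hXC.resDimCat_le_iff]
    intro M
    exact hXC.resLE_of_iso (asIso (R.adj_jLowerShriek.unit.app M)).symm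
      (R.exact_jUpperStar.resLE_map hXC hP
        (fun M hM => hXC.resDimOf_le_iff.1 h₂.ge _ ⟨M, hM, ⟨Iso.refl _⟩⟩)
        (hXB.resDimCat_le_iff.1 h₁.ge _))
  exact_mod_cast h

end Recollement

end Extri

theorem theorem4p4
    {A : Type u₁} [Category.{v₁} A] [Preadditive A] [HasZeroObject A] [HasBinaryBiproducts A]
    {B : Type u₂} [Category.{v₂} B] [Preadditive B] [HasZeroObject B] [HasBinaryBiproducts B]
    {C : Type u₃} [Category.{v₃} C] [Preadditive C] [HasZeroObject C] [HasBinaryBiproducts C]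
    (SA : Extri.ExtriangulatedStructure.{w₁} A) (SB : Extri.ExtriangulatedStructure.{w₂} B)
    (SC : Extri.ExtriangulatedStructure.{w₃} C)
    (hA : SA.WIC) (hB : SB.WIC) (hC : SC.WIC)
    (R : Extri.Recollement SA SB SC)
    (hPB : SB.HasEnoughProjectives) (hPC : SC.HasEnoughProjectives)
    (XA : ObjectProperty A) (XB : ObjectProperty B) (XC : ObjectProperty C)
    (hXA : SA.IsResolving XA) (hXB : SB.IsResolving XB) (hXC : SC.IsResolving XC) :
    -- (1)
    (SB.resDimCat XB ≤ SC.resDimCat XC +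
      max (SB.resDimOf XB (ObjectProperty.map ⊤ R.iLowerStar))
        (SB.resDimOf XB (XC.map R.jLowerShriek)) + 1) ∧
    -- (2)
    (SB.resDimOf XB (ObjectProperty.map ⊤ R.iLowerStar) ≤
      SA.resDimCat XA + SB.resDimOf XB (XA.map R.iLowerStar)) ∧
    -- (3)
    (SB.resDimCat XB ≤ SA.resDimCat XA + SC.resDimCat XC +
      max (SB.resDimOf XB (XA.map R.iLowerStar))
        (SB.resDimOf XB (XC.map R.jLowerShriek)) + 1) ∧
    -- (4)
    (SC.resDimCat XC ≤ SB.resDimCat XB + SC.resDimOf XC (XB.map R.jUpperStar)) ∧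
    -- (5)
    ((XC.map R.jLowerShriek ≤ XB ∨ XC.map R.jLowerStar ≤ XB) →
      SB.resDimCat XB ≤ SC.resDimCat XC +
          SB.resDimOf XB (ObjectProperty.map ⊤ R.iLowerStar) + 1 ∧
      SB.resDimCat XB ≤ SC.resDimCat XC + SA.resDimCat XA +
          SB.resDimOf XB (XA.map R.iLowerStar) + 1) ∧
    -- (6)
    (XA.map R.iLowerStar ≤ XB →
      SB.resDimOf XB (ObjectProperty.map ⊤ R.iLowerStar) ≤ SA.resDimCat XA) ∧
    -- (7)
    ((XC.map R.jLowerShriek ≤ XB ∨ XC.map R.jLowerStar ≤ XB) → XA.map R.iLowerStar ≤ XB →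
      SB.resDimCat XB ≤ SA.resDimCat XA + SC.resDimCat XC + 1) ∧
    -- (8)
    (XB.map R.jUpperStar ≤ XC → SC.resDimCat XC ≤ SB.resDimCat XB) := by
  have h₁ := R.resDimCat_le_shriek hC hPB hXB hXC
  have h₂ := R.resDimOf_iLowerStar_le hPB hXA hXB
  have h₄ := R.resDimCat_le_jUpperStar hPC hXB hXC
  have h₅ : (XC.map R.jLowerShriek ≤ XB ∨ XC.map R.jLowerStar ≤ XB) →
      SB.resDimCat XB ≤ SC.resDimCat XC +
        SB.resDimOf XB (ObjectProperty.map ⊤ R.iLowerStar) + 1 := by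
    rintro (h | h)
    · simpa [hXB.resDimOf_eq_zero h] using h₁
    -- The bound through `j_*` is sharper by one than required.
    · exact (R.resDimCat_le_star hC hPB hXB hXC h).trans le_self_add
  have h₆ (h : XA.map R.iLowerStar ≤ XB) :
      SB.resDimOf XB (ObjectProperty.map ⊤ R.iLowerStar) ≤ SA.resDimCat XA := by
    simpa [hXB.resDimOf_eq_zero h] using h₂
  refine ⟨h₁, h₂, h₁.trans ?_, h₄, fun h => ⟨h₅ h, (h₅ h).trans ?_⟩, h₆,
    fun h h' => (h₅ h).trans ?_, fun h => by simpa [hXC.resDimOf_eq_zero h] using h₄⟩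
  · rw [add_comm (SA.resDimCat XA), add_assoc (SC.resDimCat XC) (SA.resDimCat XA)]
    gcongr
    exact max_le (h₂.trans (add_le_add le_rfl (le_max_left _ _)))
      ((le_max_right _ _).trans le_add_self)
  · rw [add_assoc (SC.resDimCat XC) (SA.resDimCat XA)]
    gcongr
  · rw [add_comm (SA.resDimCat XA)]
    gcongr
    exact h₆ h'
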